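/- **Setting.** Consider $x_{k+1}=Ax_k+w_k$ in $\mathbb{R}^n$ and $M$ sensors $y_{m,k}=C_mx_k+v_{m,k}$, with mutually independent zero-mean Gaussian noises of covariances $Q\ge 0$ and $R_m>0$ and initial covariance $P_0\ge 0$, where each $(A,C_m)$ is detectable and $(A,Q^{1/2})$ is stabilizable. Put $f(X)=AXA^T+Q$. Let $\bar P_m$ be the steady-state filtered error covariance of the local Kalman filter of sensor $m$, i.e. the limit as $k\to\infty$ of $P^s_{m,k|k}$, where $P^s_{m,0|-1}=P_0$, $P^s_{m,k|k}=P^s_{m,k|k-1}-P^s_{m,k|k-1}C_m^T(C_mP^s_{m,k|k-1}C_m^T+R_m)^{-1}C_mP^s_{m,k|k-1}$ and $P^s_{m,k+1|k}=f(P^s_{m,k|k})$. Let $\beta\in(0,1)$, let $\lambda_m\in[0,1]$ be the packet reception probabilities and $E_m\in\mathbb{R}$ the transmission costs. Let $\mathcal{S}=\{f^i(\bar P_m): 1\le m\le M,\ i\ge 0\}$, and let $\mathcal{D}$ be a set of positive semidefinite matrices with $\mathcal{S}\subseteq\mathcal{D}$ and $f(\mathcal{D})\subseteq\mathcal{D}$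 (for instance $\mathcal{D}=\mathcal{S}$, or the set of all positive semidefinite matrices). Matrices are compared in the order $X\le Y\iff Y-X$ is positive semidefinite. Let $\mathcal{V}=\{\mathbf{e}_0,\mathbf{e}_1,\dots,\mathbf{e}_M\}\subset\{0,1\}^M$, where $\mathbf{e}_0=0$ and $\mathbf{e}_1,\dots,\mathbf{e}_M$ are the unit vectors. For $\nu\in\mathcal{V}$ put $s_m(\nu)=\nu_m\prod_{n\ne m}(1-\nu_n)\lambda_m$, and for a function $g$ on $\mathcal{D}$ put $$(Tg)(\tilde P)=\min_{\nu\in\mathcal{V}}\Big\{\beta\Big[\sum_m s_m(\nu)\,\mathrm{tr}\bar P_m+\Big(1-\sum_m s_m(\nu)\Big)\mathrm{tr} f(\tilde P)\Big]+(1-\beta)\sum_m\nu_mE_m+\sum_m s_m(\nu)g(\bar P_m)+\Big(1-\sum_m s_m(\nu)\Big)g(f(\tilde P))\Big\}.$$ Let $\rho\in\mathbb{R}$ and let $h:\mathcal{D}\to\mathbb{R}$ be the relative value function of the infinite-horizon average cost problem: $h$ satisfies the Bellman equation $\rho+h(\tilde P)=(Th)(\tilde P)$ for $\tilde P\in\mathcal{D}$,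 and it is the limit of relative value iteration, i.e. with $V_0=0$ and $V_{l+1}=TV_l$ one has $V_l(\tilde P)-V_l(\tilde P_f)\to h(\tilde P)-h(\tilde P_f)$ as $l\to\infty$, for all $\tilde P,\tilde P_f\in\mathcal{D}$. **Lemma.** (i) For $m=1,\dots,M$ the function $$\phi_m(\tilde P)=\beta\,\mathrm{tr} f(\tilde P)+h(f(\tilde P))-\beta[\lambda_m\mathrm{tr}\bar P_m+(1-\lambda_m)\mathrm{tr} f(\tilde P)]-(1-\beta)E_m-\lambda_mh(\bar P_m)-(1-\lambda_m)h(f(\tilde P))$$ is increasing on $\mathcal{D}$: if $\tilde P,\tilde P'\in\mathcal{D}$ and $\tilde P\le\tilde P'$, then $\phi_m(\tilde P)\le\phi_m(\tilde P')$. (ii) For $m=1,\dots,M$ define $$\psi_m(\tilde P)=\beta[\lambda_m\mathrm{tr}\bar P_m+(1-\lambda_m)\mathrm{tr} f(\tilde P)]+(1-\beta)E_m+\lambda_mh(\bar P_m)+(1-\lambda_m)h(f(\tilde P)).$$ Let $m,n\in\{1,\dots,M\}$ and let $\tilde P,\tilde P'\in\mathcal{D}$ with $\tilde P'\ge\tilde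 P$ and $f(\tilde P')\ne f(\tilde P)$ (for invertible $A$ this just says $\tilde P'\ne\tilde P$). If $\psi_m(\tilde P)\le\psi_n(\tilde P)$ and $\psi_m(\tilde P')\ge\psi_n(\tilde P')$, then $\psi_m(\tilde P'')\ge\psi_n(\tilde P'')$ for every $\tilde P''\in\mathcal{D}$ with $\tilde P''\ge\tilde P'$. -/

import Mathlib

open Filter Topology
open scoped MatrixOrder

noncomputable section

namespace SensorScheduling

/-- A real square matrix is (Schur) stable: all its complex eigenvalues have modulus `< 1`. -/
def IsSchurStable {n : ℕ} (A : Matrix (Fin n) (Fin n) ℝ) : Prop :=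
  ∀ z ∈ spectrum ℂ (A.map (algebraMap ℝ ℂ)), ‖z‖ < 1

/-- The pair `(A, C)` is detectable. -/
def IsDetectable {n p : ℕ} (A : Matrix (Fin n) (Fin n) ℝ) (C : Matrix (Fin p) (Fin n) ℝ) : Prop :=
  ∃ L : Matrix (Fin n) (Fin p) ℝ, IsSchurStable (A - L * C)

/-- The pair `(A, B)` is stabilizable. -/
def IsStabilizable {n p : ℕ} (A : Matrix (Fin n) (Fin n) ℝ) (B : Matrix (Fin n) (Fin p) ℝ) : Prop :=
  ∃ L : Matrix (Fin p) (Fin n) ℝ, IsSchurStable (A - B * L)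

/-- The data of the linear system `x (k+1) = A x k + w k`, observed by `M` sensors
`y m k = C m * x k + v m k`, with process noise covariance `Q`, measurement noise covariances `R m`
and covariance `P0` of the initial state; the packet reception probabilities `lam m`, the
transmission costs `E m` and the weight `beta` of the scheduling problem. -/
structure Model (n M : ℕ) where
  A : Matrix (Fin n) (Fin n) ℝ
  Q : Matrix (Fin n) (Fin n) ℝ
  P0 : Matrix (Fin n) (Fin n) ℝ
  p : Fin M → ℕ
  C : (m : Fin M) → Matrix (Fin (p m)) (Fin n) ℝ
  R : (m : Fin M) → Matrix (Fin (p m)) (Fin (p m)) ℝ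
  lam : Fin M → ℝ
  E : Fin M → ℝ
  beta : ℝ
  Q_posSemidef : Q.PosSemidef
  P0_posSemidef : P0.PosSemidef
  R_posDef : ∀ m, (R m).PosDef
  lam_nonneg : ∀ m, 0 ≤ lam m
  lam_le_one : ∀ m, lam m ≤ 1
  beta_pos : 0 < beta
  beta_lt_one : beta < 1
  detectable : ∀ m, IsDetectable A (C m)
  stabilizable : IsStabilizable A (CFC.sqrt Q)

variable {n M : ℕ}

namespace Model

/-- `f X = A X Aᵀ + Q`. -/
def f (S : Model n M) (X : Matrix (Fin n) (Fin n) ℝ) : Matrix (Fin n) (Fin n) ℝ :=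
  S.A * X * S.A.transpose + S.Q

/-- The measurement update of the local Kalman filter of sensor `m`: it takes the predicted error
covariance `P_{k|k-1}` to the filtered error covariance `P_{k|k}`. -/
def measUpdate (S : Model n M) (m : Fin M) (X : Matrix (Fin n) (Fin n) ℝ) :
    Matrix (Fin n) (Fin n) ℝ :=
  X - X * (S.C m).transpose * (S.C m * X * (S.C m).transpose + S.R m)⁻¹ * S.C m * X

/-- The predicted error covariance `P_{m,k|k-1}` of the local Kalman filter of sensor `m`. -/
def predictedCov (S : Model n M) (m : Fin M) : ℕ → Matrix (Fin n) (Fin n) ℝ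
  | 0 => S.P0
  | k + 1 => S.f (S.measUpdate m (S.predictedCov m k))

/-- The filtered error covariance `P_{m,k|k}` of the local Kalman filter of sensor `m`. -/
def filteredCov (S : Model n M) (m : Fin M) (k : ℕ) : Matrix (Fin n) (Fin n) ℝ :=
  S.measUpdate m (S.predictedCov m k)

/-- `Pbar m` is the steady state value of the filtered error covariance of sensor `m`. -/
def IsSteadyStateCov (S : Model n M) (Pbar : Fin M → Matrix (Fin n) (Fin n) ℝ) : Prop :=
  ∀ m, Tendsto (S.filteredCov m) atTop (𝓝 (Pbar m))

/-- The steady state set `𝒮 = {f^i (Pbar m) | m = 1, …, M, i = 0, 1, 2, …}`. -/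
def stateSet (S : Model n M) (Pbar : Fin M → Matrix (Fin n) (Fin n) ℝ) :
    Set (Matrix (Fin n) (Fin n) ℝ) :=
  {P | ∃ (m : Fin M) (i : ℕ), P = S.f^[i] (Pbar m)}

/-- Admissible state spaces: sets of positive semidefinite matrices that contain all possible values
`𝒮` of the error covariance and are invariant under `f`. The smallest one is `𝒮` itself, the
largest one is the set of all positive semidefinite matrices. -/
structure IsStateSpace (S : Model n M) (Pbar : Fin M → Matrix (Fin n) (Fin n) ℝ)
    (D : Set (Matrix (Fin n) (Fin n) ℝ)) : Prop where
  posSemidef : ∀ P ∈ D, P.PosSemidef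
  stateSet_subset : S.stateSet Pbar ⊆ D
  mapsTo : Set.MapsTo S.f D D

/-- The action set `𝒱 = {e_0, e_1, …, e_M}`, enumerated by `Option (Fin M)`: `e_0 = 0` (no sensor is
scheduled) and `e_m` is the `m`-th unit vector (exactly sensor `m` is scheduled). -/
def action : Option (Fin M) → Fin M → ℝ
  | none => 0
  | some m => Pi.single m 1

/-- The probability `ν_m ∏_{n ≠ m} (1 - ν_n) λ_m` that the estimate of sensor `m` is received. -/
def recvProb (S : Model n M) (ν : Fin M → ℝ) (m : Fin M) : ℝ :=
  ν m * (∏ j ∈ Finset.univ.erase m, (1 - ν j)) * S.lam m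

/-- The expression that is minimised over the actions `ν` in the Bellman equation:
expected cost of one stage plus the expected value of `h` at the next state. -/
def bellmanTerm (S : Model n M) (Pbar : Fin M → Matrix (Fin n) (Fin n) ℝ)
    (h : Matrix (Fin n) (Fin n) ℝ → ℝ) (P : Matrix (Fin n) (Fin n) ℝ) (ν : Fin M → ℝ) : ℝ :=
  S.beta * (∑ m, S.recvProb ν m * (Pbar m).trace + (1 - ∑ m, S.recvProb ν m) * (S.f P).trace)
    + (1 - S.beta) * ∑ m, ν m * S.E m
    + ∑ m, S.recvProb ν m * h (Pbar m)
    + (1 - ∑ m, S.recvProb ν m) * h (S.f P)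

/-- The right-hand side of the Bellman equation: the minimum over the actions `ν ∈ 𝒱`. -/
def bellmanOp (S : Model n M) (Pbar : Fin M → Matrix (Fin n) (Fin n) ℝ)
    (h : Matrix (Fin n) (Fin n) ℝ → ℝ) (P : Matrix (Fin n) (Fin n) ℝ) : ℝ :=
  Finset.univ.inf' ⟨none, Finset.mem_univ _⟩
    (fun a : Option (Fin M) => S.bellmanTerm Pbar h P (action a))

/-- The value functions `V_l` of value iteration, started from `V_0 = 0`. -/
def valueIter (S : Model n M) (Pbar : Fin M → Matrix (Fin n) (Fin n) ℝ) :
    ℕ → Matrix (Fin n) (Fin n) ℝ → ℝ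
  | 0 => fun _ => 0
  | l + 1 => S.bellmanOp Pbar (S.valueIter Pbar l)

/-- The iterates `h_l = V_l - V_l (Pf)` of relative value iteration with reference state `Pf`. -/
def relValueIter (S : Model n M) (Pbar : Fin M → Matrix (Fin n) (Fin n) ℝ)
    (Pf : Matrix (Fin n) (Fin n) ℝ) (l : ℕ) (P : Matrix (Fin n) (Fin n) ℝ) : ℝ :=
  S.valueIter Pbar l P - S.valueIter Pbar l Pf

/-- `h` is the relative value function on the state space `D`, with average cost `ρ` per stage:
it satisfies the Bellman equation, and (up to the additive constant that the Bellman equation leaves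
free) it is the pointwise limit of relative value iteration, with any reference state `Pf ∈ D`. -/
structure IsRelativeValueFunction (S : Model n M) (Pbar : Fin M → Matrix (Fin n) (Fin n) ℝ)
    (D : Set (Matrix (Fin n) (Fin n) ℝ)) (ρ : ℝ) (h : Matrix (Fin n) (Fin n) ℝ → ℝ) : Prop where
  bellman : ∀ P ∈ D, ρ + h P = S.bellmanOp Pbar h P
  tendsto : ∀ Pf ∈ D, ∀ P ∈ D,
    Tendsto (fun l => S.relValueIter Pbar Pf l P) atTop (𝓝 (h P - h Pf))

/-- The expected cost-to-go `ψ_m` when sensor `m` is scheduled. -/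
def psi (S : Model n M) (Pbar : Fin M → Matrix (Fin n) (Fin n) ℝ)
    (h : Matrix (Fin n) (Fin n) ℝ → ℝ) (m : Fin M) (P : Matrix (Fin n) (Fin n) ℝ) : ℝ :=
  S.beta * (S.lam m * (Pbar m).trace + (1 - S.lam m) * (S.f P).trace) + (1 - S.beta) * S.E m
    + S.lam m * h (Pbar m) + (1 - S.lam m) * h (S.f P)

/-- The difference `φ_m` between the costs-to-go of no transmission and of scheduling `m`. -/
def phi (S : Model n M) (Pbar : Fin M → Matrix (Fin n) (Fin n) ℝ)
    (h : Matrix (Fin n) (Fin n) ℝ → ℝ) (m : Fin M) (P : Matrix (Fin n) (Fin n) ℝ) : ℝ :=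
  S.beta * (S.f P).trace + h (S.f P)
    - S.beta * (S.lam m * (Pbar m).trace + (1 - S.lam m) * (S.f P).trace)
    - (1 - S.beta) * S.E m - S.lam m * h (Pbar m) - (1 - S.lam m) * h (S.f P)

end Model

end SensorScheduling

end

/-!
Write `g P = β tr (f P) + h (f P)`. Then `φ_m = λ_m g + const` and
`ψ_m - ψ_j = (λ_j - λ_m) g + const`, so everything rests on `g` being increasing on the state space.
The map `f` is order preserving, hence so is `P ↦ tr (f P)`, and the Bellman operator preserves
functions that are increasing on the state space, because the probability of receiving nothing is
nonnegative under every action (`bellmanOp_monotoneOn`). So all iterates of value iteration are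
increasing, and so is their limit `h`, up to a constant (`relativeValueFunction_monotoneOn`).

This gives the monotonicity of `φ_m`. For the threshold property of `ψ_m - ψ_j`: if `λ_m ≤ λ_j`, the
difference is increasing, so it stays nonnegative beyond `P'`. If `λ_j < λ_m`, it is decreasing, and
strictly so between `P` and `P'`, since the trace is strictly increasing and `f P ≠ f P'`; this
contradicts that the difference is nonpositive at `P` and nonnegative at `P'`.
-/

namespace SensorScheduling

theorem trace_mono {n : ℕ} {X Y : Matrix (Fin n) (Fin n) ℝ} (hXY : X ≤ Y) :
    X.trace ≤ Y.trace := by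
  have h := (Matrix.le_iff.mp hXY).trace_nonneg
  rw [Matrix.trace_sub] at h
  linarith

theorem trace_strictMono {n : ℕ} {X Y : Matrix (Fin n) (Fin n) ℝ} (hXY : X ≤ Y) (hne : X ≠ Y) :
    X.trace < Y.trace := by
  refine lt_of_le_of_ne (trace_mono hXY) fun h => hne ?_
  have h0 : (Y - X).trace = 0 := by rw [Matrix.trace_sub, h, sub_self]
  exact (sub_eq_zero.mp ((Matrix.le_iff.mp hXY).trace_eq_zero_iff.mp h0)).symm

namespace Model

variable {n M : ℕ}

theorem f_mono (S : Model n M) : Monotone S.f := by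
  intro X Y hXY
  rw [Matrix.le_iff]
  have h := (Matrix.le_iff.mp hXY).mul_mul_conjTranspose_same S.A
  rw [Matrix.conjTranspose_eq_transpose_of_trivial] at h
  convert h using 1
  simp only [f]
  noncomm_ring

theorem recvProb_action_none (S : Model n M) (m : Fin M) : S.recvProb (action none) m = 0 := by
  simp [recvProb, action]

theorem recvProb_action_some (S : Model n M) (k m : Fin M) :
    S.recvProb (action (some k)) m = if m = k then S.lam k else 0 := by
  by_cases hmk : m = k
  · subst hmk
    have hprod : ∏ j ∈ Finset.univ.erase m, (1 - (Pi.single m 1 : Fin M → ℝ) j) = 1 :=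
      Finset.prod_eq_one fun j hj => by simp [Finset.ne_of_mem_erase hj]
    simp [recvProb, action, hprod]
  · simp [recvProb, action, hmk]

theorem sum_recvProb_action_le_one (S : Model n M) (a : Option (Fin M)) :
    ∑ m, S.recvProb (action a) m ≤ 1 := by
  cases a with
  | none => simp [recvProb_action_none]
  | some k => simpa [recvProb_action_some] using S.lam_le_one k

theorem bellmanOp_monotoneOn (S : Model n M) (Pbar : Fin M → Matrix (Fin n) (Fin n) ℝ)
    {D : Set (Matrix (Fin n) (Fin n) ℝ)} (hD : Set.MapsTo S.f D D)
    {g : Matrix (Fin n) (Fin n) ℝ → ℝ} (hg : MonotoneOn g D) :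
    MonotoneOn (S.bellmanOp Pbar g) D := by
  intro P hP P' hP' hPP'
  have hf := S.f_mono hPP'
  refine Finset.inf'_mono_fun fun a _ => ?_
  have hp : 0 ≤ 1 - ∑ m, S.recvProb (action a) m :=
    sub_nonneg.mpr (S.sum_recvProb_action_le_one a)
  have hβ := S.beta_pos.le
  have ht := trace_mono hf
  have hgf := hg (hD hP) (hD hP') hf
  unfold bellmanTerm
  gcongr

theorem valueIter_monotoneOn (S : Model n M) (Pbar : Fin M → Matrix (Fin n) (Fin n) ℝ)
    {D : Set (Matrix (Fin n) (Fin n) ℝ)} (hD : Set.MapsTo S.f D D) (l : ℕ) :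
    MonotoneOn (S.valueIter Pbar l) D := by
  induction l with
  | zero => exact fun _ _ _ _ _ => le_rfl
  | succ l ih => exact S.bellmanOp_monotoneOn Pbar hD ih

theorem relativeValueFunction_monotoneOn {S : Model n M}
    {Pbar : Fin M → Matrix (Fin n) (Fin n) ℝ} {D : Set (Matrix (Fin n) (Fin n) ℝ)}
    (hD : Set.MapsTo S.f D D) {ρ : ℝ} {h : Matrix (Fin n) (Fin n) ℝ → ℝ}
    (hh : S.IsRelativeValueFunction Pbar D ρ h) : MonotoneOn h D := by
  intro P hP P' hP' hPP'
  exact sub_nonneg.mp <| ge_of_tendsto' (hh.tendsto P hP P' hP') fun l =>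
    sub_nonneg.mpr (S.valueIter_monotoneOn Pbar hD l hP hP' hPP')

end Model

end SensorScheduling

theorem mainTheorem5 {n M : ℕ} (S : SensorScheduling.Model n M)
    (Pbar : Fin M → Matrix (Fin n) (Fin n) ℝ) (hPbar : S.IsSteadyStateCov Pbar)
    (D : Set (Matrix (Fin n) (Fin n) ℝ)) (hD : S.IsStateSpace Pbar D)
    (ρ : ℝ) (h : Matrix (Fin n) (Fin n) ℝ → ℝ) (hh : S.IsRelativeValueFunction Pbar D ρ h) :
    (∀ m : Fin M, MonotoneOn (S.phi Pbar h m) D) ∧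
    (∀ m j : Fin M, ∀ P ∈ D, ∀ P' ∈ D, P ≤ P' → S.f P ≠ S.f P' →
      S.psi Pbar h m P ≤ S.psi Pbar h j P → S.psi Pbar h j P' ≤ S.psi Pbar h m P' →
      ∀ P'' ∈ D, P' ≤ P'' → S.psi Pbar h j P'' ≤ S.psi Pbar h m P'') := by
  have hmono := SensorScheduling.Model.relativeValueFunction_monotoneOn hD.mapsTo hh
  have hβ := S.beta_pos
  let g : Matrix (Fin n) (Fin n) ℝ → ℝ := fun P => S.beta * (S.f P).trace + h (S.f P)
  have hg : MonotoneOn g D := fun P hP P' hP' hPP' =>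
    add_le_add
      (mul_le_mul_of_nonneg_left (SensorScheduling.trace_mono (S.f_mono hPP')) hβ.le)
      (hmono (hD.mapsTo hP) (hD.mapsTo hP') (S.f_mono hPP'))
  have hphi (m : Fin M) (P : Matrix (Fin n) (Fin n) ℝ) : S.phi Pbar h m P =
      S.lam m * g P
        - (S.beta * S.lam m * (Pbar m).trace + (1 - S.beta) * S.E m + S.lam m * h (Pbar m)) := by
    simp only [SensorScheduling.Model.phi, g]
    ring
  have hpsi (m : Fin M) (P : Matrix (Fin n) (Fin n) ℝ) : S.psi Pbar h m P =
      (1 - S.lam m) * g P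
        + (S.beta * S.lam m * (Pbar m).trace + (1 - S.beta) * S.E m + S.lam m * h (Pbar m)) := by
    simp only [SensorScheduling.Model.psi, g]
    ring
  refine ⟨fun m P hP P' hP' hPP' => ?_, fun m j P hP P' hP' hPP' hne h1 h2 P'' hP'' hPP'' => ?_⟩
  · rw [hphi, hphi]
    exact sub_le_sub_right (mul_le_mul_of_nonneg_left (hg hP hP' hPP') (S.lam_nonneg m)) _
  · have hlt : g P < g P' :=
      add_lt_add_of_lt_of_le
        (mul_lt_mul_of_pos_left (SensorScheduling.trace_strictMono (S.f_mono hPP') hne) hβ)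
        (hmono (hD.mapsTo hP) (hD.mapsTo hP') (S.f_mono hPP'))
    have hle := hg hP' hP'' hPP''
    rw [hpsi, hpsi] at h1 h2 ⊢
    rcases le_or_gt (S.lam m) (S.lam j) with hl | hl
    · have := mul_le_mul_of_nonneg_left hle (sub_nonneg.mpr hl)
      linarith
    · have := mul_lt_mul_of_pos_left hlt (sub_pos.mpr hl)
      linarith
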